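/- Definitions. A \emph{Polish topometric group} is a triple $(G,\tau,\partial)$ where $(G,\tau)$ is a topological group whose topology is Polish, and $\partial$ is a (finite-valued, not necessarily separable) bi-invariant metric on $G$ whose topology refines $\tau$ and which is $\tau$-lower semi-continuous, i.e. $\{(x,y)\in G^2:\partial(x,y)\le r\}$ is $\tau$-closed for every $r\in\mathbb R$. It has \emph{ample generics} if for every $n\in\mathbb N$ and every $\varepsilon>0$ there is $\bar x\in G^n$ such that, for the diagonal conjugacy class $C=\{(gx_1g^{-1},\dots,gx_ng^{-1}):g\in G\}$, the set $(C)_\varepsilon=\{\bar y\in G^n:\partial(\bar y,C)<\varepsilon\}$ is co-meagre in $G^n$; here $G^n$ carries the product topology of $\tau$ (for co-meagreness) and the supremum metric of $\partial$ (for the distance to $C$). The \emph{uniform Souslin number} of a topological group $H$ is the least cardinal $\kappa$ such that for every neighbourhood $V$ of $1_H$, $H$ can be covered by fewer than $\kappa$ left translates of $V$. Theorem. Let $(G,\tau,\partial)$ be a Polish topometric group with ample generics, let $H$ be a topological group with uniform Souslin number at most $2^{\aleph_0}$ (so for every neighbourhood $V$ of $1_H$, fewer than $2^{\aleph_0}$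 left translates of $V$ cover $H$), and let $\varphi\colon G\to H$ be a group homomorphism that is continuous from $(G,\partial)$ to $H$. Then $\varphi$ is continuous from $(G,\tau)$ to $H$. Moreover, every separable topological group $H$ has uniform Souslin number at most $2^{\aleph_0}$, so the above applies to it. -/

import Mathlib

open Topology

universe u v

/-- `(X, τ, ∂)` is a topometric space: `τ` is the ambient topology, the metric `∂` is the explicit
argument `d`; the topology of `∂` refines `τ`, and `∂` is `τ`-lower semi-continuous. -/
structure IsTopometricSpace (X : Type u) [τ : TopologicalSpace X] (d : MetricSpace X) :
    Prop where
  refines : d.toUniformSpace.toTopologicalSpace ≤ τ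
  isClosed_dist_le : ∀ r : ℝ, IsClosed {p : X × X | d.dist p.1 p.2 ≤ r}

/-- `(G, τ, ∂)` is a topometric group: a topometric space such that `(G, τ)` is a topological group
and `∂` is bi-invariant. -/
structure IsTopometricGroup (G : Type u) [Group G] [TopologicalSpace G] (d : MetricSpace G) :
    Prop extends IsTopometricSpace G d, IsTopologicalGroup G where
  dist_mul_left : ∀ a x y : G, d.dist (a * x) (a * y) = d.dist x y
  dist_mul_right : ∀ a x y : G, d.dist (x * a) (y * a) = d.dist x y

/-- The enlargement `(A)_ε = {x | ∂(x, A) < ε}` of a set `A` of `n`-tuples, for the supremum metric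
on `X ^ n` induced by the metric `d` on `X`. -/
def tupleEnlargement {X : Type u} (d : MetricSpace X) {n : ℕ} (ε : ℝ) (A : Set (Fin n → X)) :
    Set (Fin n → X) :=
  letI := d
  Metric.thickening ε A

/-- An action of `Γ` on the topometric space `(X, τ, d)` has ample generics if for all `n` and
`ε > 0` there is an orbit of the diagonal action on `X ^ n` whose `ε`-enlargement is co-meagre for
the product topology of `τ`. -/
def ActionHasAmpleGenerics (Γ : Type v) (X : Type u) [Group Γ] [MulAction Γ X]
    [TopologicalSpace X] (d : MetricSpace X) : Prop :=
  ∀ (n : ℕ) (ε : ℝ), 0 < ε →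
    ∃ x : Fin n → X, tupleEnlargement d ε (MulAction.orbit Γ x) ∈ residual (Fin n → X)

/-- A topometric group has ample generics if its action on itself by conjugation has. -/
def HasAmpleGenerics (G : Type u) [Group G] [TopologicalSpace G] (d : MetricSpace G) : Prop :=
  ActionHasAmpleGenerics (ConjAct G) G d

/-- The uniform Souslin number of a topological group `H`: the least cardinal `κ` such that, for
every neighbourhood `V` of `1`, the group `H` is covered by fewer than `κ` left translates of `V`. -/
noncomputable def uniformSouslinNumber (H : Type v) [Group H] [TopologicalSpace H] :
    Cardinal.{v} :=
  sInf {κ : Cardinal.{v} | ∀ V ∈ 𝓝 (1 : H), ∃ S : Set H,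
    Cardinal.mk S < κ ∧ ∀ h : H, ∃ s ∈ S, ∃ w ∈ V, h = s * w}

/-!
Why a homomorphism `φ` as in the theorem is continuous: it suffices that `φ ⁻¹' V` is a
neighbourhood of `1` for each neighbourhood `V` of `1` in `H`. By Pettis' lemma
(`exists_nhds_one_subset_inv_mul`) this holds once `φ ⁻¹' V₁` is comeagre in some nonempty open set,
where `V₁⁻¹ * V₁ ⊆ V`. If it is not, the complement `B` of `φ ⁻¹' V₁` is nonmeagre in every nonempty
open set. Let `A` be the preimage of a much smaller neighbourhood `V₄`. It is nonmeagre: otherwise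
`x⁻¹ * y ∈ A` would be a meagre relation, and a Cantor set independent for it
(`exists_cantor_family_of_isMeagre`) cannot be covered by fewer than `2 ^ ℵ₀` translates.

Ample generics then give elements `k a`, for `a` in the Cantor space, such that for `a ≠ b` some
conjugate of a point of `A` by `k a` and some conjugate of a point of `B` by `k b` (or the same with
`a` and `b` exchanged) are `ε`-close for the metric
(`exists_cantor_family_of_hasAmpleGenerics`). As fewer than `2 ^ ℵ₀` translates cover `H`, there are
`a ≠ b` with `φ ((k a)⁻¹ * k b) ∈ V₄`. By continuity of `φ` for the metric, a point of `B` is then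
mapped into a product of four elements of `V₄`, hence into `V₁`, a contradiction.

The `k a` are limits along the branches of a binary tree. A node carries a generic tuple and a group
element; passing to a child appends a point of `A` or of `B` to the tuple, and multiplies the group
element by a small element that almost centralizes the tuple, so that conjugates of earlier points
hardly move afterwards. One such step is `exists_approx_conj_step`. The orbits of the diagonal
action need not be comeagre themselves, only their enlargements, so the step works with approximate
centralizers, and it uses that a nonmeagre continuous image of a Polish space is comeagre in some
nonempty open set (`exists_isOpen_isMeagre_diff_range`). Lower semicontinuity of the metric carries
the estimates to the limit.
-/

/-! ### Images of Polish spaces under continuous maps -/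

/-- The set of points every neighbourhood of which meets `s` in a nonmeagre set. -/
def nonmeagrePoints {Y : Type*} [TopologicalSpace Y] (s : Set Y) : Set Y :=
  {y | ∀ N ∈ 𝓝 y, ¬ IsMeagre (N ∩ s)}

lemma isClosed_nonmeagrePoints {Y : Type*} [TopologicalSpace Y] (s : Set Y) :
    IsClosed (nonmeagrePoints s) := by
  rw [← isOpen_compl_iff, isOpen_iff_mem_nhds]
  intro y hy
  simp only [nonmeagrePoints, Set.mem_compl_iff, Set.mem_ofPred_eq, not_forall, not_not] at hy
  obtain ⟨N, hN, hm⟩ := hy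
  filter_upwards [eventually_mem_nhds_iff.2 hN] with z hz hz'
  exact hz' N hz hm

lemma isMeagre_diff_nonmeagrePoints {Y : Type*} [TopologicalSpace Y] [SecondCountableTopology Y]
    (s : Set Y) : IsMeagre (s \ nonmeagrePoints s) := by
  have hB := TopologicalSpace.isBasis_countableBasis Y
  have hc : {U ∈ TopologicalSpace.countableBasis Y | IsMeagre (U ∩ s)}.Countable :=
    (TopologicalSpace.countable_countableBasis Y).mono (Set.sep_subset _ _)
  refine (isMeagre_biUnion hc (f := fun U => U ∩ s) fun U hU => hU.2).mono ?_
  rintro y ⟨hys, hy⟩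
  simp only [nonmeagrePoints, Set.mem_ofPred_eq, not_forall, not_not] at hy
  obtain ⟨N, hN, hm⟩ := hy
  obtain ⟨U, hU, hyU, hUN⟩ := hB.mem_nhds_iff.1 hN
  exact Set.mem_biUnion (x := U) ⟨hU, hm.mono (Set.inter_subset_inter_left _ hUN)⟩ ⟨hyU, hys⟩

lemma nonmeagrePoints_subset_closure {Y : Type*} [TopologicalSpace Y] (s : Set Y) :
    nonmeagrePoints s ⊆ closure s := fun _ hy =>
  mem_closure_iff_nhds.2 fun N hN => nonempty_of_not_isMeagre (hy N hN)

lemma IsClosed.isMeagre_diff_interior {Y : Type*} [TopologicalSpace Y] {s : Set Y}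
    (hs : IsClosed s) : IsMeagre (s \ interior s) := by
  rw [← hs.frontier_eq]
  exact ((isClosed_frontier).isNowhereDense_iff.2 (interior_frontier hs)).isMeagre

lemma IsOpen.isMeagre_closure_diff {Y : Type*} [TopologicalSpace Y] {s : Set Y}
    (hs : IsOpen s) : IsMeagre (closure s \ s) := by
  rw [← hs.frontier_eq]
  refine ((isClosed_frontier).isNowhereDense_iff.2 ?_).isMeagre
  rw [← frontier_compl]
  exact interior_frontier hs.isClosed_compl

/-- Passing to a countable cover loses the essential points only up to a meagre set: this is what
makes a Souslin scheme reach almost all of them. -/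
lemma isMeagre_nonmeagrePoints_diff_iUnion {Y : Type*} [TopologicalSpace Y]
    [SecondCountableTopology Y] {ι : Type*} [Countable ι] {s : Set Y} {t : ι → Set Y}
    (h : s ⊆ ⋃ i, t i) : IsMeagre (nonmeagrePoints s \ ⋃ i, nonmeagrePoints (t i)) := by
  set W : Set Y := ⋃ i, interior (nonmeagrePoints (t i)) with hW
  have hWo : IsOpen W := isOpen_iUnion fun i => isOpen_interior
  have hsW : IsMeagre (s \ W) := by
    refine (IsMeagre.union (isMeagre_iUnion fun i => isMeagre_diff_nonmeagrePoints (t i))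
      (isMeagre_iUnion fun i =>
        (isClosed_nonmeagrePoints (t i)).isMeagre_diff_interior)).mono ?_
    rintro y ⟨hys, hyW⟩
    obtain ⟨i, hi⟩ := Set.mem_iUnion.1 (h hys)
    by_cases hn : y ∈ nonmeagrePoints (t i)
    · exact Or.inr (Set.mem_iUnion.2 ⟨i, hn, fun h' => hyW (Set.mem_iUnion.2 ⟨i, h'⟩)⟩)
    · exact Or.inl (Set.mem_iUnion.2 ⟨i, hi, hn⟩)
  have hcl : nonmeagrePoints s ⊆ closure W := by
    intro y hy
    by_contra hyW
    have hsub : (closure W)ᶜ ∩ s ⊆ s \ W := fun z hz =>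
      ⟨hz.2, fun h' => hz.1 (subset_closure h')⟩
    exact hy _ (isClosed_closure.isOpen_compl.mem_nhds hyW) (hsW.mono hsub)
  refine hWo.isMeagre_closure_diff.mono ?_
  rintro y ⟨hys, hy⟩
  refine ⟨hcl hys, fun hyW => hy ?_⟩
  obtain ⟨i, hi⟩ := Set.mem_iUnion.1 hyW
  exact Set.mem_iUnion.2 ⟨i, interior_subset hi⟩

/-- The piece of `Z` with the finite address `l`, read from the last letter: each letter `i` at
position `k` confines to the ball of radius `2⁻ᵏ` about the `i`-th point of a dense sequence. -/
def ballPiece {Z : Type*} [MetricSpace Z] (e : ℕ → Z) : List ℕ → Set Z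
  | [] => Set.univ
  | i :: l => ballPiece e l ∩ Metric.ball (e i) ((1 / 2) ^ l.length)

/-- A nonmeagre continuous image of a Polish space is comeagre in some nonempty open set. -/
theorem exists_isOpen_isMeagre_diff_range {Z Y : Type*} [TopologicalSpace Z] [PolishSpace Z]
    [TopologicalSpace Y] [SecondCountableTopology Y] [T2Space Y] {f : Z → Y} (hf : Continuous f)
    (hm : ¬ IsMeagre (Set.range f)) :
    ∃ O : Set Y, IsOpen O ∧ O.Nonempty ∧ IsMeagre (O \ Set.range f) := by
  let _ := TopologicalSpace.upgradeIsCompletelyMetrizable Z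
  have : Nonempty Z := by
    obtain ⟨_, z, -⟩ := nonempty_of_not_isMeagre hm
    exact ⟨z⟩
  let e := TopologicalSpace.denseSeq Z
  have he : DenseRange e := TopologicalSpace.denseRange_denseSeq Z
  let K : List ℕ → Set Y := fun l => f '' ballPiece e l
  let U : List ℕ → Set Y := fun l => nonmeagrePoints (K l)
  have hcov : ∀ l, K l ⊆ ⋃ i, K (i :: l) := by
    rintro l _ ⟨z, hz, rfl⟩
    obtain ⟨i, hi⟩ := he.exists_dist_lt z (ε := (1 / 2) ^ l.length) (by positivity)
    exact Set.mem_iUnion.2 ⟨i, z, ⟨hz, hi⟩, rfl⟩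
  have hbad : IsMeagre (⋃ l, U l \ ⋃ i, U (i :: l)) :=
    isMeagre_iUnion fun l => isMeagre_nonmeagrePoints_diff_iUnion (hcov l)
  have hK : K [] = Set.range f := Set.image_univ
  refine ⟨interior (U []), isOpen_interior, ?_, ?_⟩
  · by_contra hne
    rw [Set.not_nonempty_iff_eq_empty] at hne
    apply hm
    have h1 : IsMeagre (U []) :=
      ((isClosed_nonmeagrePoints _).isNowhereDense_iff.2 hne).isMeagre
    refine ((isMeagre_diff_nonmeagrePoints (K [])).union h1).mono ?_
    rw [← hK]
    intro y hy
    by_cases h : y ∈ U []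
    · exact Or.inr h
    · exact Or.inl ⟨hy, h⟩
  refine hbad.mono ?_
  rintro y ⟨hyU, hyr⟩
  by_contra hy
  apply hyr
  have hstep : ∀ l : {l // y ∈ U l}, ∃ i, y ∈ U (i :: l.1) := by
    intro l
    by_contra hl
    exact hy (Set.mem_iUnion.2 ⟨l.1, l.2, fun h => hl (Set.mem_iUnion.1 h)⟩)
  choose c hc using hstep
  let L : ℕ → {l // y ∈ U l} := fun n =>
    Nat.rec ⟨[], interior_subset hyU⟩ (fun _ l => ⟨c l :: l.1, hc l⟩) n
  have hLs : ∀ n, (L (n + 1)).1 = c (L n) :: (L n).1 := fun n => rfl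
  have hlen : ∀ n, (L n).1.length = n := by
    intro n
    induction n with
    | zero => rfl
    | succ n ih => rw [hLs, List.length_cons, ih]
  have hanti : Antitone fun n => ballPiece e (L n).1 :=
    antitone_nat_of_succ_le fun n => by
      rw [hLs]
      exact Set.inter_subset_left
  have hdist : ∀ n, ∀ z ∈ ballPiece e (L (n + 1)).1, ∀ w ∈ ballPiece e (L (n + 1)).1,
      dist z w ≤ 2 * (1 / 2) ^ n := by
    intro n z hz w hw
    rw [hLs] at hz hw
    have h1 := hz.2
    have h2 := hw.2
    rw [hlen, Metric.mem_ball] at h1 h2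
    have := dist_triangle_right z w (e (c (L n)))
    linarith
  have hne : ∀ n, (ballPiece e (L n).1).Nonempty := by
    intro n
    have : (K (L n).1).Nonempty :=
      closure_nonempty_iff.1 ⟨y, nonmeagrePoints_subset_closure _ (L n).2⟩
    exact this.of_image
  choose k hk using hne
  have hlim0 : Filter.Tendsto (fun n : ℕ => 2 * (1 / 2 : ℝ) ^ n) Filter.atTop (𝓝 0) := by
    simpa using (tendsto_pow_atTop_nhds_zero_of_lt_one (r := (1 / 2 : ℝ)) (by norm_num)
      (by norm_num)).const_mul 2
  have hcau : CauchySeq fun n => k (n + 1) := by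
    refine cauchySeq_of_le_tendsto_0' _ (fun n m hnm => ?_) hlim0
    exact hdist n _ (hk (n + 1)) _ (hanti (by omega : n + 1 ≤ m + 1) (hk (m + 1)))
  obtain ⟨z, hz⟩ := cauchySeq_tendsto_of_complete hcau
  refine ⟨z, ?_⟩
  by_contra hzy
  obtain ⟨A, B, hA, hB, hzA, hyB, hAB⟩ := t2_separation hzy
  obtain ⟨r, hr, hrA⟩ := Metric.isOpen_iff.1 (hA.preimage hf) z hzA
  obtain ⟨n, hn1, hn2⟩ := ((hlim0.eventually_lt_const (half_pos hr)).and
    (hz.eventually (Metric.ball_mem_nhds z (half_pos hr)))).exists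
  obtain ⟨_, hxB, x, hx, rfl⟩ := mem_closure_iff.1
    (nonmeagrePoints_subset_closure _ (L (n + 1)).2) B hB hyB
  refine Set.disjoint_left.1 hAB (hrA ?_) hxB
  have h1 := hdist n x hx _ (hk (n + 1))
  have h2 := dist_triangle x (k (n + 1)) z
  have h3 : dist (k (n + 1)) z < r / 2 := hn2
  rw [Metric.mem_ball]
  linarith

/-! ### Cantor sets avoiding a meagre relation -/

/-- One level of the scheme: given closed balls indexed by `J`, choose for each `t` in a finite set
`I` a smaller ball inside the one at `p t`, such that pairs taken from different new balls lie in a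
given dense open set. -/
lemma exists_closedBall_refinement {X I J : Type*} [MetricSpace X] [CompleteSpace X] [Fintype I]
    (p : I → J) {D : Set (X × X)} (hDo : IsOpen D) (hD : Dense D) (c : J → X) {r : ℝ}
    (hr : 0 < r) :
    ∃ (c' : I → X) (r' : ℝ), 0 < r' ∧ r' ≤ r / 2 ∧
      (∀ t, Metric.closedBall (c' t) r' ⊆ Metric.closedBall (c (p t)) r) ∧
      ∀ t t', t ≠ t' → ∀ x ∈ Metric.closedBall (c' t) r', ∀ y ∈ Metric.closedBall (c' t') r',
        (x, y) ∈ D := by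
  classical
  -- The centres of the new balls form a point of the Baire space `I → X`, where each of the finitely
  -- many conditions is open and dense.
  let E : I × I → Set (I → X) := fun q => {z | q.1 ≠ q.2 → (z q.1, z q.2) ∈ D}
  have hEo : ∀ q, IsOpen (E q) := by
    intro q
    by_cases h : q.1 = q.2
    · simp [E, h]
    · simp only [E, ne_eq, h, not_false_eq_true, forall_const]
      exact hDo.preimage (by fun_prop)
  have hEd : ∀ q, Dense (E q) := by
    intro q
    by_cases h : q.1 = q.2
    · simp [E, h]
    · simp only [E, ne_eq, h, not_false_eq_true, forall_const]
      refine hD.preimage (f := fun z : I → X => (z q.1, z q.2)) (IsOpenMap.of_sections fun z =>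
        ⟨fun w => Function.update (Function.update z q.1 w.1) q.2 w.2, ?_, ?_, ?_⟩)
      · exact ((continuous_const.update q.1 continuous_fst).update q.2
          continuous_snd).continuousAt
      · simp
      · intro w
        simp [Function.update_of_ne h]
  have hE : Dense (⋂ q, E q) := dense_iInter_of_isOpen hEo hEd
  have hballs : IsOpen {z : I → X | ∀ t, z t ∈ Metric.ball (c (p t)) r} := by
    simp only [Set.ofPred_forall]
    exact isOpen_iInter_of_finite fun t => Metric.isOpen_ball.preimage (continuous_apply t)
  obtain ⟨z, hz, hzE⟩ := hE.inter_open_nonempty _ hballs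
    ⟨fun t => c (p t), fun t => Metric.mem_ball_self hr⟩
  obtain ⟨ρ, hρ, hρz⟩ := Metric.nhds_basis_closedBall.mem_iff.1
    ((hballs.inter (isOpen_iInter_of_finite hEo)).mem_nhds ⟨hz, hzE⟩)
  have hle : min ρ (r / 2) ≤ ρ := min_le_left _ _
  have hmem : ∀ w : I → X, (∀ t, dist (w t) (z t) ≤ min ρ (r / 2)) →
      (∀ t, w t ∈ Metric.ball (c (p t)) r) ∧ ∀ t t', t ≠ t' → (w t, w t') ∈ D := by
    intro w hw
    obtain ⟨h1, h2⟩ := hρz (Metric.mem_closedBall.2 ((dist_pi_le_iff hρ.le).2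
      fun t => (hw t).trans hle))
    exact ⟨h1, fun t t' h => Set.mem_iInter.1 h2 (t, t') h⟩
  have h0 : 0 < min ρ (r / 2) := lt_min hρ (half_pos hr)
  refine ⟨z, min ρ (r / 2), h0, min_le_right _ _, ?_, ?_⟩
  · intro t x hx
    have := (hmem (Function.update z t x) fun s => ?_).1 t
    · rw [Function.update_self] at this
      exact Metric.ball_subset_closedBall this
    · by_cases h : s = t
      · subst h
        rw [Function.update_self]
        exact hx
      · rw [Function.update_of_ne h, dist_self]
        exact h0.le
  · intro t t' htt x hx y hy
    have := (hmem (Function.update (Function.update z t x) t' y) fun s => ?_).2 t t' htt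
    · rwa [Function.update_self, Function.update_of_ne htt, Function.update_self] at this
    · by_cases h : s = t'
      · subst h
        rw [Function.update_self]
        exact hy
      · rw [Function.update_of_ne h]
        by_cases h' : s = t
        · subst h'
          rw [Function.update_self]
          exact hx
        · rw [Function.update_of_ne h', dist_self]
          exact h0.le

/-- A form of Mycielski's theorem: a meagre relation on a Polish space has an independent family
indexed by the Cantor space. For a reflexive relation the family is injective. -/
theorem exists_cantor_family_of_isMeagre {X : Type*} [TopologicalSpace X] [PolishSpace X]
    [Nonempty X] {R : Set (X × X)} (hR : IsMeagre R) :
    ∃ f : (ℕ → Bool) → X, ∀ a b, a ≠ b → (f a, f b) ∉ R := by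
  let _ := TopologicalSpace.upgradeIsCompletelyMetrizable X
  obtain ⟨T, hTR, hTG, hTd⟩ := mem_residual.1 hR
  obtain ⟨F, hFo, rfl⟩ := hTG.eq_iInter_nat
  let D : ℕ → Set (X × X) := fun n => ⋂ k ∈ Set.Iic n, F k
  have hDo : ∀ n, IsOpen (D n) := fun n => (Set.finite_Iic n).isOpen_biInter fun k _ => hFo k
  have hDd : ∀ n, Dense (D n) := fun n => hTd.mono fun x hx =>
    Set.mem_iInter₂.2 fun k _ => Set.mem_iInter.1 hx k
  have hstep : ∀ (n : ℕ) (q : {q : ((Fin n → Bool) → X) × ℝ // 0 < q.2}),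
      ∃ q' : {q : ((Fin (n + 1) → Bool) → X) × ℝ // 0 < q.2}, q'.1.2 ≤ q.1.2 / 2 ∧
        (∀ t, Metric.closedBall (q'.1.1 t) q'.1.2 ⊆
          Metric.closedBall (q.1.1 (fun i => t i.castSucc)) q.1.2) ∧
        ∀ t t', t ≠ t' → ∀ x ∈ Metric.closedBall (q'.1.1 t) q'.1.2,
          ∀ y ∈ Metric.closedBall (q'.1.1 t') q'.1.2, (x, y) ∈ D n := by
    intro n q
    obtain ⟨c, r, hr, h⟩ := exists_closedBall_refinement
      (fun (t : Fin (n + 1) → Bool) (i : Fin n) => t i.castSucc) (hDo n) (hDd n) q.1.1 q.2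
    exact ⟨⟨(c, r), hr⟩, h⟩
  choose next hnext1 hnext2 hnext3 using hstep
  let x₀ : X := Classical.arbitrary X
  let L : ∀ n, {q : ((Fin n → Bool) → X) × ℝ // 0 < q.2} := fun n =>
    Nat.rec ⟨(fun _ => x₀, 1), one_pos⟩ (fun n q => next n q) n
  have hL : ∀ n, L (n + 1) = next n (L n) := fun n => rfl
  let c : ℕ → (ℕ → Bool) → X := fun n a => (L n).1.1 fun i => a i
  let r : ℕ → ℝ := fun n => (L n).1.2
  have hr : ∀ n, r n ≤ (1 / 2) ^ n := by
    intro n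
    induction n with
    | zero => exact le_of_eq (by simp [r, L])
    | succ n ih =>
      have h1 : r (n + 1) ≤ r n / 2 := hnext1 n (L n)
      rw [pow_succ]
      linarith
  have hanti : ∀ a, Antitone fun n => Metric.closedBall (c n a) (r n) := fun a =>
    antitone_nat_of_succ_le fun n => hnext2 n (L n) fun i => a i
  have hmem : ∀ a n m, n ≤ m → c m a ∈ Metric.closedBall (c n a) (r n) := fun a n m h =>
    hanti a h (Metric.mem_closedBall_self (L m).2.le)
  have hlim : ∀ a, ∃ x, Filter.Tendsto (fun n => c n a) Filter.atTop (𝓝 x) := by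
    intro a
    refine cauchySeq_tendsto_of_complete (cauchySeq_of_le_tendsto_0' (fun n => (1 / 2 : ℝ) ^ n)
      (fun n m hnm => ?_) (tendsto_pow_atTop_nhds_zero_of_lt_one (by norm_num) (by norm_num)))
    rw [dist_comm]
    exact (hmem a n m hnm).trans (hr n)
  choose f hf using hlim
  have hfm : ∀ a n, f a ∈ Metric.closedBall (c n a) (r n) := fun a n =>
    Metric.isClosed_closedBall.mem_of_tendsto (hf a)
      (Filter.eventually_atTop.2 ⟨n, fun m hm => hmem a n m hm⟩)
  refine ⟨f, fun a b hab => hTR (Set.mem_iInter.2 fun k => ?_)⟩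
  obtain ⟨i, hi⟩ := Function.ne_iff.1 hab
  have := hnext3 (max i k) (L (max i k)) (fun i => a i) (fun i => b i)
    (fun h => hi (congrFun h ⟨i, by omega⟩)) (f a) (hfm a (max i k + 1))
    (f b) (hfm b (max i k + 1))
  exact Set.mem_iInter₂.1 this k (le_max_right i k)

/-! ### Comeagre sets in products -/

/-- The part of the Kuratowski–Ulam theorem that needs no Baire property: almost all sections of a
comeagre set are comeagre. -/
theorem eventually_residual_prod {X Y : Type*} [TopologicalSpace X] [TopologicalSpace Y]
    [SecondCountableTopology Y] {p : X × Y → Prop} (h : ∀ᶠ q in residual (X × Y), p q) :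
    ∀ᶠ x in residual X, ∀ᶠ y in residual Y, p (x, y) := by
  obtain ⟨S, hSo, hSd, hSc, hS⟩ := mem_residual_iff.1 h
  have key : ∀ U ∈ S, ∀ᶠ x in residual X, Dense {y | (x, y) ∈ U} := by
    intro U hU
    have hB := TopologicalSpace.isBasis_countableBasis Y
    have h1 : ∀ V ∈ TopologicalSpace.countableBasis Y,
        ∀ᶠ x in residual X, ∃ y ∈ V, (x, y) ∈ U := by
      intro V hV
      have hVo := hB.isOpen hV
      have hVne := TopologicalSpace.nonempty_of_mem_countableBasis hV
      have heq : {x | ∃ y ∈ V, (x, y) ∈ U} = Prod.fst '' (U ∩ Set.univ ×ˢ V) := by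
        ext x
        constructor
        · rintro ⟨y, hy, hxy⟩
          exact ⟨(x, y), ⟨hxy, trivial, hy⟩, rfl⟩
        · rintro ⟨⟨x', y⟩, ⟨hxy, -, hy⟩, rfl⟩
          exact ⟨y, hy, hxy⟩
      refine residual_of_dense_open (s := {x | ∃ y ∈ V, (x, y) ∈ U}) ?_ ?_
      · rw [heq]
        exact isOpenMap_fst _ ((hSo U hU).inter (isOpen_univ.prod hVo))
      · rw [dense_iff_inter_open]
        rintro O hO ⟨x, hx⟩
        obtain ⟨y, hy⟩ := hVne
        obtain ⟨⟨x', y'⟩, ⟨hx', hy'⟩, hU'⟩ := (hSd U hU).inter_open_nonempty (O ×ˢ V)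
          (hO.prod hVo) ⟨(x, y), hx, hy⟩
        exact ⟨x', hx', y', hy', hU'⟩
    filter_upwards [(eventually_countable_ball
      (TopologicalSpace.countable_countableBasis Y)).2 h1] with x hx
    refine dense_iff_inter_open.2 fun O hO ⟨y, hy⟩ => ?_
    obtain ⟨V, hV, hyV, hVO⟩ := hB.mem_nhds_iff.1 (hO.mem_nhds hy)
    obtain ⟨z, hz, hzU⟩ := hx V hV
    exact ⟨z, hVO hz, hzU⟩
  filter_upwards [(eventually_countable_ball hSc).2 key] with x hx
  have h2 : ∀ U ∈ S, ∀ᶠ y in residual Y, (x, y) ∈ U := fun U hU =>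
    residual_of_dense_open ((hSo U hU).preimage (by fun_prop)) (hx U hU)
  filter_upwards [(eventually_countable_ball hSc).2 h2] with y hy
  exact hS hy

/-- Almost every sequence stays in a given comeagre set after almost every change of a given
entry. -/
lemma eventually_residual_update {G : Type*} [TopologicalSpace G] [SecondCountableTopology G]
    {p : (ℕ → G) → Prop} (h : ∀ᶠ x in residual (ℕ → G), p x) (n : ℕ) :
    ∀ᶠ x in residual (ℕ → G), ∀ᶠ y in residual G, p (Function.update x n y) := by
  have hc : Continuous fun q : (ℕ → G) × G => Function.update q.1 n q.2 :=
    continuous_fst.update n continuous_snd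
  refine eventually_residual_prod (p := fun q => p (Function.update q.1 n q.2))
    ((tendsto_residual_of_isOpenMap hc (IsOpenMap.of_sections fun q =>
      ⟨fun z => (Function.update z n (q.1 n), z n), ?_, ?_, ?_⟩)).eventually h)
  · exact ((continuous_id.update n continuous_const).prodMk (continuous_apply n)).continuousAt
  · simp
  · intro z
    simp

/-- A property of finite tuples that holds generically holds for the initial segments of generic
sequences. -/
lemma eventually_residual_initial {G : Type*} [TopologicalSpace G] {n : ℕ}
    {p : (Fin n → G) → Prop} (h : ∀ᶠ x in residual (Fin n → G), p x) :
    ∀ᶠ x in residual (ℕ → G), p fun i => x i := by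
  have hc : Continuous fun (x : ℕ → G) (i : Fin n) => x i := by fun_prop
  refine (tendsto_residual_of_isOpenMap hc (IsOpenMap.of_sections fun x =>
    ⟨fun z i => if h : i < n then z ⟨i, h⟩ else x i, ?_, ?_, ?_⟩)).eventually h
  · refine Continuous.continuousAt (continuous_pi fun i => ?_)
    by_cases h : i < n
    · simp only [h, dite_true]
      fun_prop
    · simp only [h, dite_false]
      fun_prop
  · ext i
    simp
  · intro z
    ext i
    simp

/-- A comeagre set of sequences contains a comeagre set that is stable under almost every change of
any one entry. -/
lemma exists_residual_update_stable {G : Type*} [TopologicalSpace G] [SecondCountableTopology G]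
    {E : Set (ℕ → G)} (hE : E ∈ residual (ℕ → G)) :
    ∃ P ∈ residual (ℕ → G), P ⊆ E ∧
      ∀ x ∈ P, ∀ n, ∀ᶠ y in residual G, Function.update x n y ∈ P := by
  let Q : ℕ → Set (ℕ → G) := fun k =>
    Nat.rec E (fun _ S => {x ∈ S | ∀ n, ∀ᶠ y in residual G, Function.update x n y ∈ S}) k
  have hQ : ∀ k, Q (k + 1) =
      {x ∈ Q k | ∀ n, ∀ᶠ y in residual G, Function.update x n y ∈ Q k} := fun k => rfl
  have hQr : ∀ k, ∀ᶠ x in residual (ℕ → G), x ∈ Q k := by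
    intro k
    induction k with
    | zero => exact hE
    | succ k ih =>
      filter_upwards [ih, eventually_countable_forall.2 fun n =>
        eventually_residual_update ih n] with x h1 h2
      exact ⟨h1, h2⟩
  refine ⟨⋂ k, Q k, countable_iInter_mem.2 hQr, Set.iInter_subset Q 0, fun x hx n => ?_⟩
  have := eventually_countable_forall.2 fun k => (Set.mem_iInter.1 hx (k + 1)).2 n
  filter_upwards [this] with y hy
  exact Set.mem_iInter.2 hy

/-! ### Generic tuples in a topometric group -/

lemma IsTopometricGroup.dist_conj {G : Type*} [Group G] [TopologicalSpace G] {d : MetricSpace G}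
    (hd : IsTopometricGroup G d) (g x y : G) :
    d.dist (g * x * g⁻¹) (g * y * g⁻¹) = d.dist x y := by
  rw [hd.dist_mul_right, hd.dist_mul_left]

lemma IsTopometricGroup.dist_conj_inv {G : Type*} [Group G] [TopologicalSpace G]
    {d : MetricSpace G} (hd : IsTopometricGroup G d) (g x y : G) :
    d.dist (g⁻¹ * x * g) y = d.dist x (g * y * g⁻¹) := by
  rw [← hd.dist_conj g (g⁻¹ * x * g) y]
  congr 1
  group

lemma exists_conj_of_mem_tupleEnlargement {G : Type*} [Group G] {d : MetricSpace G} {n : ℕ}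
    {ε : ℝ} {x y : Fin n → G}
    (h : y ∈ tupleEnlargement d ε (MulAction.orbit (ConjAct G) x)) :
    ∃ g : G, ∀ i, d.dist (y i) (g * x i * g⁻¹) < ε := by
  let _ := d
  obtain ⟨_, ⟨g, rfl⟩, hz⟩ := Metric.mem_thickening_iff.1 h
  exact ⟨ConjAct.ofConjAct g, fun i => (dist_le_pi_dist y _ i).trans_lt hz⟩

/-- With ample generics there is a set of sequences that is stable under generic changes of single
entries, and in which the initial segments of any two members are approximately conjugate. -/
lemma exists_generic_sequences {G : Type*} [Group G] [TopologicalSpace G] [PolishSpace G]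
    {d : MetricSpace G} (hd : IsTopometricGroup G d) (hag : HasAmpleGenerics G d) :
    ∃ P : Set (ℕ → G), P.Nonempty ∧
      (∀ x ∈ P, ∀ n, ∀ᶠ y in residual G, Function.update x n y ∈ P) ∧
      ∀ x ∈ P, ∀ x' ∈ P, ∀ (n : ℕ) (δ : ℝ), 0 < δ →
        ∃ g : G, ∀ i < n, d.dist (g * x i * g⁻¹) (x' i) < δ := by
  have hpos : ∀ m : ℕ, (0 : ℝ) < 1 / ((m : ℝ) + 1) := fun m => Nat.one_div_pos_of_nat
  choose z hz using fun n m : ℕ => hag n (1 / ((m : ℝ) + 1)) (hpos m)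
  have hE : ∀ᶠ x in residual (ℕ → G), ∀ n m : ℕ, (fun i : Fin n => x i) ∈
      tupleEnlargement d (1 / ((m : ℝ) + 1)) (MulAction.orbit (ConjAct G) (z n m)) :=
    eventually_countable_forall.2 fun n => eventually_countable_forall.2 fun m =>
      eventually_residual_initial (hz n m)
  obtain ⟨P, hP, hPE, hPs⟩ := exists_residual_update_stable hE
  refine ⟨P, (dense_of_mem_residual hP).nonempty, hPs, fun x hx x' hx' n δ hδ => ?_⟩
  obtain ⟨m, hm⟩ := exists_nat_one_div_lt (half_pos hδ)
  obtain ⟨g, hg⟩ := exists_conj_of_mem_tupleEnlargement (hPE hx n m)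
  obtain ⟨g', hg'⟩ := exists_conj_of_mem_tupleEnlargement (hPE hx' n m)
  refine ⟨g' * g⁻¹, fun i hi => ?_⟩
  have h1 := hg ⟨i, hi⟩
  have h2 := hg' ⟨i, hi⟩
  rw [← hd.dist_conj (g' * g⁻¹)] at h1
  rw [show g' * g⁻¹ * (g * z n m ⟨i, hi⟩ * g⁻¹) * (g' * g⁻¹)⁻¹ = g' * z n m ⟨i, hi⟩ * g'⁻¹ by
    group] at h1
  have h3 := @dist_triangle_right G d.toPseudoMetricSpace (g' * g⁻¹ * x i * (g' * g⁻¹)⁻¹) (x' i)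
    (g' * z n m ⟨i, hi⟩ * g'⁻¹)
  linarith

/-- The local homogeneity step. For a generic `y₀`, the set `T` of all `y` that are close to a
conjugate of `y₀` by a small element almost centralizing `x 0, …, x (n - 1)` is nonmeagre:
countably many translates of it cover all generic `y`. As a projection of a closed set it is
comeagre in some nonempty open set, hence meets `B`. -/
lemma exists_approx_conj_step {G : Type*} [Group G] [TopologicalSpace G] [PolishSpace G]
    {d : MetricSpace G} (hd : IsTopometricGroup G d) {P : Set (ℕ → G)}
    (hPs : ∀ x ∈ P, ∀ n, ∀ᶠ y in residual G, Function.update x n y ∈ P)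
    (hPc : ∀ x ∈ P, ∀ x' ∈ P, ∀ (n : ℕ) (δ : ℝ), 0 < δ →
      ∃ g : G, ∀ i < n, d.dist (g * x i * g⁻¹) (x' i) < δ)
    {A B : Set G} (hA : ¬ IsMeagre A)
    (hB : ∀ O : Set G, IsOpen O → O.Nonempty → ¬ IsMeagre (O ∩ B))
    {x : ℕ → G} (hx : x ∈ P) (n : ℕ) {V : Set G} (hV : V ∈ 𝓝 1) {δ : ℝ} (hδ : 0 < δ) :
    ∃ y₀ ∈ A, ∃ y₁ ∈ B, ∃ h ∈ V, Function.update x n y₀ ∈ P ∧ Function.update x n y₁ ∈ P ∧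
      (∀ i < n, d.dist (h * x i * h⁻¹) (x i) ≤ δ) ∧ d.dist (h * y₁ * h⁻¹) y₀ ≤ δ := by
  have := hd.toIsTopologicalGroup
  have hgood := hPs x hx n
  have hmeet : ∀ S : Set G, ¬ IsMeagre S → ∃ y ∈ S, Function.update x n y ∈ P := by
    intro S hS
    by_contra! hcon
    refine hS (Filter.mem_of_superset hgood ?_)
    exact fun y hy hyS => hcon y hyS hy
  obtain ⟨y₀, hy₀A, hy₀⟩ := hmeet A hA
  obtain ⟨V', hV', hV'c, hV'inv, hV'V⟩ := exists_closed_nhds_one_inv_eq_mul_subset hV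
  have hV'sub : V' ⊆ V := fun v hv =>
    hV'V (by simpa using Set.mul_mem_mul hv (mem_of_mem_nhds hV'))
  let F : Set (G × G) := {q | q.1 ∈ V' ∧ (∀ i < n, d.dist (q.1 * x i * q.1⁻¹) (x i) ≤ δ) ∧
    d.dist (q.1 * y₀ * q.1⁻¹) q.2 ≤ δ}
  have hFx : IsClosed {q : G × G | ∀ i < n, d.dist (q.1 * x i * q.1⁻¹) (x i) ≤ δ} := by
    simp only [Set.ofPred_forall]
    refine isClosed_iInter fun i => isClosed_iInter fun _ => ?_
    exact (hd.isClosed_dist_le δ).preimage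
      (f := fun q : G × G => (q.1 * x i * q.1⁻¹, x i)) (by fun_prop)
  have hF : IsClosed F := by
    refine (hV'c.preimage continuous_fst).inter (IsClosed.inter ?_ ?_)
    · exact hFx
    · exact (hd.isClosed_dist_le δ).preimage
        (f := fun q : G × G => (q.1 * y₀ * q.1⁻¹, q.2)) (by fun_prop)
  let T : Set G := {y | ∃ v, (v, y) ∈ F}
  have hT : ¬ IsMeagre T := by
    intro hTm
    -- By the Lindelöf property, translates of `V'` by countably many elements of the approximate
    -- centralizer `S` cover `S`. Translating back stays in `S` up to doubling the error.
    let S : Set G := {g | ∀ i < n, d.dist (g * x i * g⁻¹) (x i) < δ / 2}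
    obtain ⟨c, hcS, hcc, hc⟩ := TopologicalSpace.countable_cover_nhdsWithin (s := S)
      (f := fun g => (fun k => g⁻¹ * k) ⁻¹' V') fun g _ => by
        refine mem_nhdsWithin_of_mem_nhds (ContinuousAt.preimage_mem_nhds (by fun_prop) ?_)
        simpa using hV'
    have hconj : ∀ g : G, IsMeagre ((fun y => g⁻¹ * y * g) ⁻¹' T) := by
      intro g
      refine hTm.preimage_of_isOpenMap (by fun_prop) (IsOpenMap.of_inverse
        (f' := fun y => g * y * g⁻¹) (by fun_prop) (fun y => ?_) fun y => ?_)
      · group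
      · group
    refine not_isMeagre_of_mem_residual hgood
      ((isMeagre_biUnion hcc fun g _ => hconj g).mono ?_)
    intro y hy
    obtain ⟨k, hk⟩ := hPc _ hy₀ _ hy (n + 1) (δ / 2) (half_pos hδ)
    have hkx : ∀ i < n, d.dist (k * x i * k⁻¹) (x i) < δ / 2 := by
      intro i hi
      have := hk i (by omega)
      rwa [Function.update_of_ne (by omega), Function.update_of_ne (by omega)] at this
    have hky : d.dist (k * y₀ * k⁻¹) y < δ / 2 := by
      have := hk n (by omega)
      rwa [Function.update_self, Function.update_self] at this
    obtain ⟨g, hg, hgk⟩ := Set.mem_iUnion₂.1 (hc hkx)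
    refine Set.mem_iUnion₂.2 ⟨g, hg, g⁻¹ * k, hgk, fun i hi => ?_, ?_⟩
    · have h1 := hd.dist_conj_inv g (k * x i * k⁻¹) (x i)
      have h2 := @dist_triangle_right G d.toPseudoMetricSpace (k * x i * k⁻¹) (g * x i * g⁻¹) (x i)
      have h3 := hkx i hi
      have h4 := hcS hg i hi
      rw [show g⁻¹ * k * x i * (g⁻¹ * k)⁻¹ = g⁻¹ * (k * x i * k⁻¹) * g by group, h1]
      linarith
    · change d.dist (g⁻¹ * k * y₀ * (g⁻¹ * k)⁻¹) (g⁻¹ * y * g) ≤ δ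
      rw [show g⁻¹ * k * y₀ * (g⁻¹ * k)⁻¹ = g⁻¹ * (k * y₀ * k⁻¹) * g by group, hd.dist_conj_inv,
        show g * (g⁻¹ * y * g) * g⁻¹ = y by group]
      linarith
  have := hF.polishSpace
  have hrange : Set.range (fun q : F => q.1.2) = T := by
    ext y
    constructor
    · rintro ⟨⟨⟨v, y⟩, hq⟩, rfl⟩
      exact ⟨v, hq⟩
    · rintro ⟨v, hv⟩
      exact ⟨⟨(v, y), hv⟩, rfl⟩
  obtain ⟨O, hO, hOne, hOT⟩ := exists_isOpen_isMeagre_diff_range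
    (f := fun q : F => q.1.2) (by fun_prop) (by rwa [hrange])
  rw [hrange] at hOT
  have hBT : ¬ IsMeagre (B ∩ T) := by
    intro hm
    refine hB O hO hOne ((hOT.union hm).mono ?_)
    rintro y ⟨hyO, hyB⟩
    by_cases hyT : y ∈ T
    · exact Or.inr ⟨hyB, hyT⟩
    · exact Or.inl ⟨hyO, hyT⟩
  obtain ⟨y₁, ⟨hy₁B, v, hv, hvx, hvy⟩, hy₁⟩ := hmeet _ hBT
  refine ⟨y₀, hy₀A, y₁, hy₁B, v⁻¹, hV'sub (by rw [← hV'inv]; simpa using hv), hy₀, hy₁,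
    fun i hi => ?_, ?_⟩
  · rw [inv_inv, hd.dist_conj_inv, @dist_comm G d.toPseudoMetricSpace]
    exact hvx i hi
  · rw [inv_inv, hd.dist_conj_inv, @dist_comm G d.toPseudoMetricSpace]
    exact hvy

/-- In a Polish space convergence of a sequence can be ensured by choosing each term close enough to
its predecessor. -/
lemma exists_nhds_forall_tendsto (X : Type*) [TopologicalSpace X] [PolishSpace X] :
    ∃ U : ℕ → X → Set X, (∀ n x, U n x ∈ 𝓝 x) ∧
      ∀ s : ℕ → X, (∀ n, s (n + 1) ∈ U n (s n)) → ∃ x, Filter.Tendsto s Filter.atTop (𝓝 x) := by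
  let _ := TopologicalSpace.upgradeIsCompletelyMetrizable X
  refine ⟨fun n x => Metric.closedBall x ((1 / 2) ^ n),
    fun n x => Metric.closedBall_mem_nhds x (by positivity), fun s hs => ?_⟩
  refine cauchySeq_tendsto_of_complete (cauchySeq_of_le_geometric (1 / 2) 1 (by norm_num)
    fun n => ?_)
  rw [dist_comm, one_mul]
  exact hs n

/-- The tree of approximate conjugations. Two branches `a` and `b` that first differ at `n`, with
`a n = 0` and `b n = 1`, have conjugators `k a` and `k b` that bring some point of `A` and some
point of `B` within `ε` of each other. -/
theorem exists_cantor_family_of_hasAmpleGenerics {G : Type*} [Group G] [TopologicalSpace G]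
    [PolishSpace G] {d : MetricSpace G} (hd : IsTopometricGroup G d) (hag : HasAmpleGenerics G d)
    {A B : Set G} (hA : ¬ IsMeagre A)
    (hB : ∀ O : Set G, IsOpen O → O.Nonempty → ¬ IsMeagre (O ∩ B)) {ε : ℝ} (hε : 0 < ε) :
    ∃ k : (ℕ → Bool) → G, ∀ (a b : ℕ → Bool) (n : ℕ), (∀ i < n, a i = b i) → a n = false →
      b n = true → ∃ y₀ ∈ A, ∃ y₁ ∈ B,
        d.dist (k a * y₀ * (k a)⁻¹) (k b * y₁ * (k b)⁻¹) ≤ ε := by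
  have := hd.toIsTopologicalGroup
  obtain ⟨U, hU, hUlim⟩ := exists_nhds_forall_tendsto G
  obtain ⟨P, ⟨x₀, hx₀⟩, hPs, hPc⟩ := exists_generic_sequences hd hag
  -- The entries of a sequence in `P` with index below the level of the node form its tuple. The drift
  -- allowed at level `n` is chosen so that all drifts add up to at most `ε / 4`.
  have hstep : ∀ (n : ℕ) (q : P × G), ∃ q' : Bool → P × G,
      ((q' false).1.1 n ∈ A ∧ (q' true).1.1 n ∈ B) ∧
      (∀ b, ∀ i < n, (q' b).1.1 i = q.1.1 i) ∧
      (∀ b, (q' b).2 ∈ U n q.2) ∧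
      (∀ b, ∀ i < n, d.dist ((q' b).2 * q.1.1 i * (q' b).2⁻¹) (q.2 * q.1.1 i * q.2⁻¹) ≤
        ε / 4 * (1 / 2) ^ (n + 1)) ∧
      d.dist ((q' false).2 * (q' false).1.1 n * (q' false).2⁻¹)
        ((q' true).2 * (q' true).1.1 n * (q' true).2⁻¹) ≤ ε / 4 := by
    rintro n ⟨⟨x, hx⟩, g⟩
    have hV : (fun h => g * h) ⁻¹' U n g ∈ 𝓝 (1 : G) :=
      ContinuousAt.preimage_mem_nhds (by fun_prop) (by simpa using hU n g)
    obtain ⟨y₀, hy₀, y₁, hy₁, h, hh, hx₀P, hx₁P, hhx, hhy⟩ :=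
      exists_approx_conj_step hd hPs hPc hA hB hx n hV
        (show 0 < ε / 4 * (1 / 2) ^ (n + 1) by positivity)
    have hmul : ∀ y, g * h * y * (g * h)⁻¹ = g * (h * y * h⁻¹) * g⁻¹ := fun y => by group
    refine ⟨fun b => bif b then (⟨_, hx₁P⟩, g * h) else (⟨_, hx₀P⟩, g), ?_, ?_, ?_, ?_, ?_⟩
    · simp [hy₀, hy₁]
    · rintro (_ | _) i hi <;> simp [Function.update_of_ne hi.ne]
    · rintro (_ | _)
      · exact mem_of_mem_nhds (hU n g)
      · exact hh
    · rintro (_ | _) i hi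
      · change d.dist (g * x i * g⁻¹) (g * x i * g⁻¹) ≤ _
        rw [@dist_self G d.toPseudoMetricSpace]
        positivity
      · change d.dist (g * h * x i * (g * h)⁻¹) (g * x i * g⁻¹) ≤ _
        rw [hmul, hd.dist_conj]
        exact hhx i hi
    · simp only [cond_false, cond_true, Function.update_self]
      rw [hmul, hd.dist_conj, @dist_comm G d.toPseudoMetricSpace]
      refine hhy.trans (mul_le_of_le_one_right (by positivity) ?_)
      exact pow_le_one₀ (by norm_num) (by norm_num)
  choose next hAB hfix hnear hmove hmeet using hstep
  let L : (ℕ → Bool) → ℕ → P × G := fun a n =>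
    Nat.rec (⟨x₀, hx₀⟩, 1) (fun n q => next n q (a n)) n
  have hL : ∀ a n, L a (n + 1) = next n (L a n) (a n) := fun a n => rfl
  have hLeq : ∀ (a b : ℕ → Bool) (n : ℕ), (∀ i < n, a i = b i) → L a n = L b n := by
    intro a b n
    induction n with
    | zero => exact fun _ => rfl
    | succ n ih =>
      intro h
      rw [hL, hL, ih fun i hi => h i (by omega), h n (by omega)]
  have hlim : ∀ a, ∃ g, Filter.Tendsto (fun n => (L a n).2) Filter.atTop (𝓝 g) := fun a =>
    hUlim _ fun n => hnear n (L a n) (a n)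
  choose k hk using hlim
  have hconst : ∀ a n m, n + 1 ≤ m → (L a m).1.1 n = (L a (n + 1)).1.1 n := by
    intro a n m hm
    induction m, hm using Nat.le_induction with
    | base => rfl
    | succ m hm ih => rw [hL, hfix m _ _ n (by omega), ih]
  have hdrift : ∀ a n m, n + 1 ≤ m →
      d.dist ((L a m).2 * (L a (n + 1)).1.1 n * (L a m).2⁻¹)
        ((L a (n + 1)).2 * (L a (n + 1)).1.1 n * (L a (n + 1)).2⁻¹) ≤
          ε / 4 * (1 - (1 / 2) ^ m) := by
    intro a n m hm
    induction m, hm using Nat.le_induction with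
    | base =>
      rw [@dist_self G d.toPseudoMetricSpace]
      have : (1 / 2 : ℝ) ^ (n + 1) ≤ 1 := pow_le_one₀ (by norm_num) (by norm_num)
      exact mul_nonneg (by positivity) (by linarith)
    | succ m hm ih =>
      have h1 := hmove m (L a m) (a m) n (by omega)
      rw [← hL, hconst a n m hm] at h1
      refine (@dist_triangle G d.toPseudoMetricSpace _ _ _).trans ((add_le_add h1 ih).trans ?_)
      rw [pow_succ]
      linarith
  have hdriftlim : ∀ a n, d.dist (k a * (L a (n + 1)).1.1 n * (k a)⁻¹)
      ((L a (n + 1)).2 * (L a (n + 1)).1.1 n * (L a (n + 1)).2⁻¹) ≤ ε / 4 := by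
    intro a n
    -- The metric `d` is only lower semicontinuous, which suffices to pass to the limit.
    have hcl := (hd.isClosed_dist_le (ε / 4)).preimage
      (f := fun g : G => (g * (L a (n + 1)).1.1 n * g⁻¹,
        (L a (n + 1)).2 * (L a (n + 1)).1.1 n * (L a (n + 1)).2⁻¹)) (by fun_prop)
    refine hcl.mem_of_tendsto (hk a) (Filter.eventually_atTop.2 ⟨n + 1, fun m hm => ?_⟩)
    refine (hdrift a n m hm).trans (mul_le_of_le_one_right (by positivity) ?_)
    have : (0 : ℝ) ≤ (1 / 2) ^ m := by positivity
    linarith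
  refine ⟨k, fun a b n hab ha hb => ?_⟩
  have ha' : L a (n + 1) = next n (L a n) false := by rw [hL, ha]
  have hb' : L b (n + 1) = next n (L a n) true := by rw [hL, hb, hLeq a b n hab]
  refine ⟨(L a (n + 1)).1.1 n, ?_, (L b (n + 1)).1.1 n, ?_, ?_⟩
  · rw [ha']
    exact (hAB n (L a n)).1
  · rw [hb']
    exact (hAB n (L a n)).2
  have h1 := hdriftlim a n
  have h2 := hdriftlim b n
  have h3 := hmeet n (L a n)
  rw [← ha', ← hb'] at h3
  rw [@dist_comm G d.toPseudoMetricSpace] at h2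
  refine (@dist_triangle4 G d.toPseudoMetricSpace _ _ _ _).trans
    ((add_le_add (add_le_add h1 h3) h2).trans ?_)
  linarith

/-! ### Automatic continuity -/

lemma exists_cover_of_uniformSouslinNumber_le {H : Type v} [Group H] [TopologicalSpace H]
    (hH : uniformSouslinNumber H ≤ Cardinal.continuum) {V : Set H} (hV : V ∈ 𝓝 1) :
    ∃ S : Set H, Cardinal.mk S < Cardinal.continuum ∧ ∀ h : H, ∃ s ∈ S, ∃ w ∈ V, h = s * w := by
  have hne : {κ : Cardinal.{v} | ∀ V ∈ 𝓝 (1 : H), ∃ S : Set H,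
      Cardinal.mk S < κ ∧ ∀ h : H, ∃ s ∈ S, ∃ w ∈ V, h = s * w}.Nonempty := by
    refine ⟨Order.succ (Cardinal.mk H), fun V hV => ⟨Set.univ, ?_, fun h =>
      ⟨h, trivial, 1, mem_of_mem_nhds hV, (mul_one h).symm⟩⟩⟩
    rw [Cardinal.mk_univ]
    exact Order.lt_succ _
  obtain ⟨S, hS, hcov⟩ := csInf_mem hne V hV
  exact ⟨S, hS.trans_le hH, hcov⟩

lemma uniformSouslinNumber_le_continuum {H : Type v} [Group H] [TopologicalSpace H]
    [IsTopologicalGroup H] [TopologicalSpace.SeparableSpace H] :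
    uniformSouslinNumber H ≤ Cardinal.continuum := by
  refine csInf_le' fun V hV => ?_
  obtain ⟨S, hS, hSd⟩ := TopologicalSpace.exists_countable_dense H
  refine ⟨S, hS.le_aleph0.trans_lt Cardinal.aleph0_lt_continuum, fun h => ?_⟩
  have hN : (fun s => s⁻¹ * h) ⁻¹' V ∈ 𝓝 h :=
    ContinuousAt.preimage_mem_nhds (by fun_prop) (by simpa using hV)
  obtain ⟨s, hsS, hsV⟩ := (hSd.inter_nhds_nonempty hN)
  exact ⟨s, hsS, s⁻¹ * h, hsV, by group⟩

/-- Two members of a continuum of elements of `H` lie in one translate of a given neighbourhood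
of `1`. -/
lemma exists_ne_inv_mul_mem {H : Type v} [Group H] [TopologicalSpace H]
    (hH : uniformSouslinNumber H ≤ Cardinal.continuum) {V W : Set H} (hV : V ∈ 𝓝 1)
    (hVW : ∀ v ∈ V, ∀ w ∈ V, v⁻¹ * w ∈ W) (f : (ℕ → Bool) → H) :
    ∃ a b, a ≠ b ∧ (f a)⁻¹ * f b ∈ W := by
  obtain ⟨S, hS, hcov⟩ := exists_cover_of_uniformSouslinNumber_le hH hV
  choose s hs w hw hsw using fun a => hcov (f a)
  have hninj : ¬ Function.Injective fun a => (⟨s a, hs a⟩ : S) := by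
    intro hinj
    have h1 := Cardinal.lift_mk_le_lift_mk_of_injective hinj
    simp only [Cardinal.mk_pi, Cardinal.mk_bool, Cardinal.prod_const, Cardinal.lift_id,
      Cardinal.mk_nat, Cardinal.two_power_aleph0, Cardinal.lift_continuum,
      Cardinal.lift_uzero] at h1
    exact (h1.trans_lt hS).ne rfl
  obtain ⟨a, b, hab, hne⟩ := by simpa [Function.Injective] using hninj
  refine ⟨a, b, hne, ?_⟩
  rw [hsw a, hsw b, hab]
  simpa [mul_assoc] using hVW _ (hw a) _ (hw b)

/-- A form of Pettis' lemma: if `W` is comeagre in a nonempty open set, then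
the quotients of its elements cover a neighbourhood of `1`. -/
lemma exists_nhds_one_subset_inv_mul {G : Type*} [Group G] [TopologicalSpace G]
    [IsTopologicalGroup G] [BaireSpace G] {O W : Set G} (hO : IsOpen O) (hOne : O.Nonempty)
    (hOW : IsMeagre (O \ W)) : ∀ᶠ g in 𝓝 (1 : G), ∃ x ∈ W, ∃ y ∈ W, g = x⁻¹ * y := by
  obtain ⟨o, ho⟩ := hOne
  have hN : (fun g => o * g) ⁻¹' O ∈ 𝓝 (1 : G) :=
    (hO.preimage (by fun_prop)).mem_nhds (by simpa using ho)
  filter_upwards [hN] with g hg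
  have h1 : IsMeagre ((fun w => w * g) ⁻¹' (O \ W)) :=
    hOW.preimage_of_isOpenMap (by fun_prop) (isOpenMap_mul_right g)
  have h2 : ¬ IsMeagre (O ∩ (fun w => w * g) ⁻¹' O) :=
    not_isMeagre_of_isOpen (hO.inter (hO.preimage (by fun_prop))) ⟨o, ho, hg⟩
  by_contra! hcon
  refine h2 ((hOW.union h1).mono ?_)
  rintro w ⟨hwO, hwgO⟩
  by_cases hw : w ∈ W
  · exact Or.inr ⟨hwgO, fun hwg => hcon w hw (w * g) hwg (by group)⟩
  · exact Or.inl ⟨hwO, hw⟩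

/-- Preimages of neighbourhoods of `1` are nonmeagre: a meagre preimage would give a meagre relation
on `G`, and a Cantor set independent for it would need `2 ^ ℵ₀` translates. -/
lemma not_isMeagre_preimage {G : Type*} {H : Type v} [Group G] [TopologicalSpace G]
    [IsTopologicalGroup G] [PolishSpace G] [Group H] [TopologicalSpace H] [IsTopologicalGroup H]
    (hH : uniformSouslinNumber H ≤ Cardinal.continuum) (φ : G →* H) {V : Set H} (hV : V ∈ 𝓝 1) :
    ¬ IsMeagre (φ ⁻¹' V) := by
  intro hm
  obtain ⟨V', hV', -, hinv, hmul⟩ := exists_closed_nhds_one_inv_eq_mul_subset hV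
  have hR : IsMeagre ((fun q : G × G => q.1⁻¹ * q.2) ⁻¹' (φ ⁻¹' V)) :=
    hm.preimage_of_isOpenMap (by fun_prop) (IsOpenMap.of_sections fun q =>
      ⟨fun g => (q.1, q.1 * g), by fun_prop, by simp, fun g => by simp⟩)
  obtain ⟨f, hf⟩ := exists_cantor_family_of_isMeagre hR
  obtain ⟨a, b, hab, hmem⟩ := exists_ne_inv_mul_mem hH hV' (W := V)
    (fun v hv w hw => hmul (Set.mul_mem_mul (by rw [← hinv]; simpa using hv) hw)) (φ ∘ f)
  exact hf a b hab (by simpa using hmem)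

theorem mainTheorem1 {H : Type v} [Group H] [σ : TopologicalSpace H] [IsTopologicalGroup H] :
    (TopologicalSpace.SeparableSpace H → uniformSouslinNumber H ≤ Cardinal.continuum) ∧
    (uniformSouslinNumber H ≤ Cardinal.continuum →
      ∀ (G : Type u) [Group G] [τ : TopologicalSpace G] [PolishSpace G] (d : MetricSpace G),
        IsTopometricGroup G d → HasAmpleGenerics G d →
        ∀ φ : G →* H,
          Continuous[d.toUniformSpace.toTopologicalSpace, σ] φ →
          Continuous[τ, σ] φ) := by
  refine ⟨fun _ => uniformSouslinNumber_le_continuum, ?_⟩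
  intro hH G _ τ _ d hd hag φ hφ
  have := hd.toIsTopologicalGroup
  refine continuous_of_continuousAt_one φ ?_
  rw [ContinuousAt, map_one]
  intro V hV
  obtain ⟨V₁, hV₁, -, hinv₁, hmul₁⟩ := exists_closed_nhds_one_inv_eq_mul_subset hV
  obtain ⟨V₂, hV₂, -, -, hmul₂⟩ := exists_closed_nhds_one_inv_eq_mul_subset hV₁
  obtain ⟨V₃, hV₃, -, -, hmul₃⟩ := exists_closed_nhds_one_inv_eq_mul_subset hV₂
  obtain ⟨V₄, hV₄, -, hinv₄, hmul₄⟩ := exists_closed_nhds_one_inv_eq_mul_subset hV₃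
  obtain ⟨V₅, hV₅, -, hinv₅, hmul₅⟩ := exists_closed_nhds_one_inv_eq_mul_subset hV₄
  obtain ⟨ε, hε, hball⟩ : ∃ ε > 0, ∀ g : G, d.dist g 1 ≤ ε → φ g ∈ V₄ := by
    have h1 : φ ⁻¹' V₄ ∈ @nhds G d.toUniformSpace.toTopologicalSpace 1 :=
      (@Continuous.continuousAt G H d.toUniformSpace.toTopologicalSpace σ φ 1 hφ)
        (by rwa [map_one])
    obtain ⟨ε, hε, h⟩ := (@Metric.nhds_basis_closedBall G d.toPseudoMetricSpace 1).mem_iff.1 h1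
    exact ⟨ε, hε, fun g hg => h hg⟩
  -- Either `φ ⁻¹' V₁` is comeagre in some open set, or its complement is nonmeagre everywhere.
  obtain ⟨O, hO, hOne, hOm⟩ : ∃ O : Set G, IsOpen O ∧ O.Nonempty ∧ IsMeagre (O \ φ ⁻¹' V₁) := by
    by_contra! hcon
    obtain ⟨k, hk⟩ := exists_cantor_family_of_hasAmpleGenerics hd hag
      (not_isMeagre_preimage hH φ hV₄) (B := (φ ⁻¹' V₁)ᶜ) hcon hε
    have hsymm : ∀ v ∈ V₄, v⁻¹ ∈ V₄ := fun v hv => by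
      rw [← hinv₄]
      simpa using hv
    obtain ⟨a, b, hab, hmem⟩ := exists_ne_inv_mul_mem hH hV₅ (W := V₄)
      (fun v hv w hw => hmul₅ (Set.mul_mem_mul (by rw [← hinv₅]; simpa using hv) hw)) (φ ∘ k)
    have hV₄₃ : V₄ ⊆ V₃ := fun v hv =>
      hmul₄ (by simpa using Set.mul_mem_mul hv (mem_of_mem_nhds hV₄))
    have hV₃₂ : V₃ ⊆ V₂ := fun v hv =>
      hmul₃ (by simpa using Set.mul_mem_mul hv (mem_of_mem_nhds hV₃))
    -- With `u = (k b)⁻¹ * k a`, a point of `B` is within `ε` of `u * y₀ * u⁻¹` for some `y₀` in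
    -- `φ ⁻¹' V₄`, so `φ` maps it into a product of four elements of `V₄`.
    have key : ∀ a b, φ ((k b)⁻¹ * k a) ∈ V₄ → ∀ n, (∀ i < n, a i = b i) → a n = false →
        b n = true → False := by
      intro a b hu n hn ha hb
      obtain ⟨y₀, hy₀, y₁, hy₁, hd₀₁⟩ := hk a b n hn ha hb
      apply hy₁
      set u := (k b)⁻¹ * k a with hu_def
      have h1 : d.dist ((u * y₀ * u⁻¹)⁻¹ * y₁) 1 ≤ ε := by
        rw [← hd.dist_mul_left (u * y₀ * u⁻¹), mul_inv_cancel_left, mul_one,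
          ← hd.dist_conj (k b), @dist_comm G d.toPseudoMetricSpace]
        convert hd₀₁ using 2
        rw [hu_def]
        group
      have h2 : y₁ = u * y₀ * u⁻¹ * ((u * y₀ * u⁻¹)⁻¹ * y₁) := by group
      rw [Set.mem_preimage, h2, map_mul, map_mul, map_mul, map_inv]
      exact hmul₂ (Set.mul_mem_mul (hmul₃ (Set.mul_mem_mul (hmul₄ (Set.mul_mem_mul hu hy₀))
        (hV₄₃ (hsymm _ hu)))) (hV₃₂ (hV₄₃ (hball _ h1))))
    have hmem' : φ ((k b)⁻¹ * k a) ∈ V₄ := by simpa using hsymm _ hmem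
    have hmem'' : φ ((k a)⁻¹ * k b) ∈ V₄ := by simpa using hmem
    classical
    have hex := Function.ne_iff.1 hab
    have hmin : ∀ i < Nat.find hex, a i = b i := fun i hi => not_not.1 (Nat.find_min hex hi)
    have hne := Nat.find_spec hex
    cases ha : a (Nat.find hex) with
    | false => exact key a b hmem' _ hmin ha (by simpa [ha] using hne.symm)
    | true =>
      exact key b a hmem'' _ (fun i hi => (hmin i hi).symm) (by simpa [ha] using hne) ha
  refine (exists_nhds_one_subset_inv_mul hO hOne hOm).mono ?_
  rintro g ⟨x, hx, y, hy, rfl⟩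
  rw [map_mul, map_inv]
  exact hmul₁ (Set.mul_mem_mul (by rw [← hinv₁]; simpa using hx) hy)
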